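/- Let $p$ be a real polynomial in $n$ variables, homogeneous of degree $d$, and hyperbolic with respect to $e\in\mathbb{R}^n$: $p(e)>0$ and, for every $x\in\mathbb{R}^n$, the univariate polynomial $t\mapsto p(te-x)$ has only real roots. These roots, counted with multiplicity, are called the hyperbolic eigenvalues of $x$; the hyperbolic rank of $x$ is the number of nonzero hyperbolic eigenvalues of $x$, counted with multiplicity. Let $$\Lambda_+(p,e)=\{x\in\mathbb{R}^n : \text{all hyperbolic eigenvalues of } x \text{ are nonnegative}\}$$ be the hyperbolicity cone. For a convex cone $K\subseteq\mathbb{R}^n$, a face of $K$ is a convex subset $F\subseteq K$ such that $x,y\in K$ and $\alpha x+(1-\alpha)y\in F$ for some $\alpha\in(0,1)$ imply $x,y\in F$. Let $\ell(K)$ be the maximum length $\ell$ of a chain $F_1\subsetneq F_2\subsetneq\cdots\subsetneq F_\ell$ of nonempty faces of $K$. An extreme ray of $K$ is a face of the form $\{tv : t\ge 0\}$ with $v\neq 0$, and its hyperbolic rank (for $K=\Lambda_+(p,e)$) is the hyperbolic rank of its nonzero points. Suppose that $\Lambda_+(p,e)$ is pointed, that is, $\Lambda_+(p,e)\cap(-\Lambda_+(p,e))=\{0\}$,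 and that every extreme ray of $\Lambda_+(p,e)$ has hyperbolic rank one. Then $$\ell(\Lambda_+(p,e))=d+1.$$ -/

import Mathlib

namespace ConeFaces

variable {E : Type*} [AddCommGroup E] [Module ℝ E]

/-- `F` is a face of `K`: a convex subset of `K` such that, whenever a point `α x + (1 - α) y`
with `x, y ∈ K` and `0 < α < 1` lies in `F`, both `x` and `y` lie in `F`. The empty set is a
face. -/
structure IsFace (K F : Set E) : Prop where
  convex : Convex ℝ F
  subset : F ⊆ K
  mem_of_mem : ∀ x ∈ K, ∀ y ∈ K, ∀ α : ℝ, 0 < α → α < 1 →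
    α • x + (1 - α) • y ∈ F → x ∈ F ∧ y ∈ F

/-- `ℓ(K)`: the maximum number of members of a chain (for strict inclusion) of nonempty faces of
`K`. It is a supremum in `ℕ∞`, hence attained as soon as it is finite. -/
noncomputable def chainLength (K : Set E) : ℕ∞ :=
  Set.chainHeight {F : Set E | IsFace K F ∧ F.Nonempty} (fun F G => F ⊂ G)

/-- The cone `C` is pointed: `C ∩ (-C) = {0}`. -/
def IsPointed (C : Set E) : Prop := C ∩ -C = {0}

/-- `R` is an extreme ray of `K`: a face of `K` that is a half-line `ℝ₊ v` with `v ≠ 0`. -/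
def IsExtremeRay (K R : Set E) : Prop :=
  IsFace K R ∧ ∃ v : E, v ≠ 0 ∧ R = {x | ∃ t : ℝ, 0 ≤ t ∧ x = t • v}

end ConeFaces

namespace Hyperbolic

variable {n : ℕ}

/-- The univariate polynomial `t ↦ p(t e - x)`. -/
noncomputable def charPoly (p : MvPolynomial (Fin n) ℝ) (e x : Fin n → ℝ) : Polynomial ℝ :=
  MvPolynomial.aeval
    (fun i => Polynomial.X * Polynomial.C (e i) - Polynomial.C (x i) : Fin n → Polynomial ℝ) p

theorem eval_charPoly (p : MvPolynomial (Fin n) ℝ) (e x : Fin n → ℝ) (t : ℝ) :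
    (charPoly p e x).eval t = MvPolynomial.eval (t • e - x) p := by
  unfold charPoly
  rw [← Polynomial.coe_evalRingHom, MvPolynomial.aeval_def, MvPolynomial.hom_eval₂,
    MvPolynomial.eval]
  congr 1
  · ext
    simp
  · funext i
    simp
    ring

/-- `p` is hyperbolic of degree `d` with respect to `e`: it is homogeneous of degree `d`,
`p(e) > 0`, and for every `x` the polynomial `t ↦ p(t e - x)` has only real roots
(equivalently, no complex root is non-real). -/
structure IsHyperbolic (p : MvPolynomial (Fin n) ℝ) (e : Fin n → ℝ) (d : ℕ) : Prop where
  homogeneous : p.IsHomogeneous d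
  eval_pos : 0 < MvPolynomial.eval e p
  real_roots : ∀ (x : Fin n → ℝ) (z : ℂ), Polynomial.aeval z (charPoly p e x) = 0 → z.im = 0

/-- The hyperbolic eigenvalues of `x`, with multiplicity: the roots of `t ↦ p(t e - x)`. -/
noncomputable def eigenvalues (p : MvPolynomial (Fin n) ℝ) (e x : Fin n → ℝ) : Multiset ℝ :=
  (charPoly p e x).roots

/-- The hyperbolicity cone `Λ₊(p, e)`: all hyperbolic eigenvalues are nonnegative. -/
def cone (p : MvPolynomial (Fin n) ℝ) (e : Fin n → ℝ) : Set (Fin n → ℝ) :=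
  {x | ∀ t ∈ eigenvalues p e x, 0 ≤ t}

/-- The hyperbolic rank of `x`: the number of nonzero hyperbolic eigenvalues, with
multiplicity. -/
noncomputable def rank (p : MvPolynomial (Fin n) ℝ) (e x : Fin n → ℝ) : ℕ :=
  ((eigenvalues p e x).filter (fun t => t ≠ 0)).card

end Hyperbolic

/-! Both bounds come from comparing hyperbolic rank with the facial structure. By Gårding's theorem
`p` is hyperbolic in every direction of the open cone, and `cone p e` is contained in the cone of
each such direction. Hence the cone is convex, and `p` is monotone along it: adding a cone element
`y` to `z` multiplies `p(z)` by the product of `1 + r` over the nonnegative eigenvalues `r` of `y`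
in direction `z`. For `x` in the cone, `p(x + t e)` has exact order `t ^ nullity` as `t` tends to
`0` from above, so statements about rank become growth estimates.

Upper bound: if adding `y` to `x` does not raise the rank, then `x - ε y` stays in the cone for some
`ε > 0`, so `y` lies in every face containing `x` (`exists_sub_smul_mem_cone`). The maximal rank on
a face therefore increases strictly along a chain, and its values lie in `0, ..., d`.

Lower bound: start at `e`, of rank `d`, and repeatedly subtract the largest admissible multiple of
an extreme ray of the current minimal face. The minimal face shrinks strictly, while subadditivity
of rank (`rank_add_le`) and the rank-one hypothesis let the rank drop by at most one. This allows
`d` subtractions, hence `d + 1` faces. -/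

namespace Hyperbolic

open Polynomial

/-! ### Restriction of a homogeneous polynomial to a line. -/

section Line

variable {σ R : Type*} [CommRing R]

theorem eval_smul_of_isHomogeneous {q : MvPolynomial σ R} {d : ℕ} (hq : q.IsHomogeneous d)
    (c : R) (x : σ → R) : MvPolynomial.eval (c • x) q = c ^ d * MvPolynomial.eval x q := by
  rw [MvPolynomial.eval_eq, MvPolynomial.eval_eq, Finset.mul_sum]
  refine Finset.sum_congr rfl fun m hm => ?_
  have hd : ∑ i ∈ m.support, m i = d := (hq.degree_eq_sum_deg_support hm).symm
  simp only [Pi.smul_apply, smul_eq_mul, mul_pow, Finset.prod_mul_distrib]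
  rw [Finset.prod_pow_eq_pow_sum, hd]
  ring

/-- The univariate polynomial `t ↦ q(t a - w)`. -/
noncomputable def linePoly (q : MvPolynomial σ R) (a w : σ → R) : R[X] :=
  MvPolynomial.aeval (fun i => X * C (a i) - C (w i)) q

theorem eval_linePoly (q : MvPolynomial σ R) (a w : σ → R) (t : R) :
    (linePoly q a w).eval t = MvPolynomial.eval (t • a - w) q := by
  unfold linePoly
  rw [← Polynomial.coe_evalRingHom, MvPolynomial.aeval_def, MvPolynomial.hom_eval₂,
    MvPolynomial.eval]
  congr 1
  · ext
    simp
  · funext i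
    simp
    ring

theorem natDegree_le_and_coeff_prod_linear (a w : σ → R) (m : σ → ℕ) (s : Finset σ) :
    (∏ i ∈ s, (X * C (a i) - C (w i)) ^ m i).natDegree ≤ ∑ i ∈ s, m i ∧
    (∏ i ∈ s, (X * C (a i) - C (w i)) ^ m i).coeff (∑ i ∈ s, m i) = ∏ i ∈ s, a i ^ m i := by
  classical
  induction s using Finset.induction_on with
  | empty => simp
  | insert i s hi ih =>
    have h1 : (X * C (a i) - C (w i)).natDegree ≤ 1 := by compute_degree
    have h2 : (X * C (a i) - C (w i)).coeff 1 = a i := by simp [coeff_C]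
    have h3 : ((X * C (a i) - C (w i)) ^ m i).natDegree ≤ m i := by
      simpa using natDegree_pow_le_of_le (m i) h1
    have h4 : ((X * C (a i) - C (w i)) ^ m i).coeff (m i) = a i ^ m i := by
      have := coeff_pow_of_natDegree_le (m := m i) h1
      rw [h2, mul_one] at this
      exact this
    rw [Finset.prod_insert hi, Finset.sum_insert hi, Finset.prod_insert hi]
    exact ⟨natDegree_mul_le_of_le h3 ih.1, by
      rw [coeff_mul_add_eq_of_natDegree_le h3 ih.1, h4, ih.2]⟩

theorem linePoly_eq_sum (q : MvPolynomial σ R) (a w : σ → R) :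
    linePoly q a w = ∑ m ∈ q.support,
      C (q.coeff m) * ∏ i ∈ m.support, (X * C (a i) - C (w i)) ^ m i := by
  rw [linePoly, MvPolynomial.aeval_def, MvPolynomial.eval₂_eq]
  rfl

variable {q : MvPolynomial σ R} {d : ℕ} (hq : q.IsHomogeneous d) (a w : σ → R)
include hq

theorem natDegree_linePoly_le : (linePoly q a w).natDegree ≤ d := by
  rw [linePoly_eq_sum]
  refine natDegree_sum_le_of_forall_le _ _ fun m hm => ?_
  have hd : ∑ i ∈ m.support, m i = d := (hq.degree_eq_sum_deg_support hm).symm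
  rw [← hd]
  exact (natDegree_C_mul_le _ _).trans (natDegree_le_and_coeff_prod_linear a w m _).1

theorem coeff_linePoly : (linePoly q a w).coeff d = MvPolynomial.eval a q := by
  rw [linePoly_eq_sum, finsetSum_coeff, MvPolynomial.eval_eq]
  refine Finset.sum_congr rfl fun m hm => ?_
  have hd : ∑ i ∈ m.support, m i = d := (hq.degree_eq_sum_deg_support hm).symm
  rw [coeff_C_mul, ← (natDegree_le_and_coeff_prod_linear a w m _).2, hd]

variable {a} (ha : MvPolynomial.eval a q ≠ 0)
include ha

theorem natDegree_linePoly : (linePoly q a w).natDegree = d :=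
  natDegree_eq_of_le_of_coeff_ne_zero (natDegree_linePoly_le hq a w)
    (by rwa [coeff_linePoly hq])

theorem leadingCoeff_linePoly : (linePoly q a w).leadingCoeff = MvPolynomial.eval a q := by
  rw [leadingCoeff, natDegree_linePoly hq w ha, coeff_linePoly hq]

end Line

end Hyperbolic

namespace Hyperbolic

open Polynomial

/-! ### Zero-free half-planes and their stability under deformation. -/

section HalfPlane

variable {n d : ℕ} {q : MvPolynomial (Fin n) ℂ} (hq : q.IsHomogeneous d)
include hq

/-- Every root `r` has negative real part, so each factor satisfies `‖t - r‖ ≥ t.re`. The bound does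
not involve `w`, so it survives limits in `w`; this replaces Hurwitz's theorem. -/
theorem norm_mul_re_pow_le_norm_eval {a w : Fin n → ℂ}
    (h : ∀ t : ℂ, 0 ≤ t.re → MvPolynomial.eval (w + t • a) q ≠ 0) {t : ℂ} (ht : 0 ≤ t.re) :
    ‖MvPolynomial.eval a q‖ * t.re ^ d ≤ ‖MvPolynomial.eval (w + t • a) q‖ := by
  by_cases ha : MvPolynomial.eval a q = 0
  · simp [ha]
  have hs : (linePoly q a (-w)).Splits := IsAlgClosed.splits _
  have he : ∀ t : ℂ, (linePoly q a (-w)).eval t = MvPolynomial.eval (w + t • a) q := fun t => by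
    rw [eval_linePoly]; congr 2; abel
  have hcard : (linePoly q a (-w)).roots.card = d := by
    rw [← hs.natDegree_eq_card_roots, natDegree_linePoly hq _ ha]
  rw [← he, hs.eval_eq_prod_roots, leadingCoeff_linePoly hq _ ha, norm_mul]
  refine mul_le_mul_of_nonneg_left ?_ (norm_nonneg _)
  have hroot : ∀ r ∈ (linePoly q a (-w)).roots, t.re ≤ ‖t - r‖ := fun r hr => by
    have hr0 : r.re < 0 := by
      by_contra! h0
      refine h r h0 ?_
      rw [← he]
      exact (mem_roots'.1 hr).2
    have := Complex.re_le_norm (t - r)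
    rw [Complex.sub_re] at this
    linarith
  rw [← hcard]
  generalize (linePoly q a (-w)).roots = s at hroot
  induction s using Multiset.induction_on with
  | empty => simp
  | cons r s ih =>
    rw [Multiset.card_cons, pow_succ', Multiset.map_cons, Multiset.prod_cons, norm_mul]
    exact mul_le_mul (hroot r (Multiset.mem_cons_self r s))
      (ih fun r' hr' => hroot r' (Multiset.mem_cons_of_mem hr')) (by positivity) (norm_nonneg _)

/-- A nonzero leading coefficient bounds the roots of `t ↦ q(w + t a)` in terms of `w`. -/
theorem exists_bound_of_eval_eq_zero {a : Fin n → ℂ} (ha : MvPolynomial.eval a q ≠ 0) (M : ℝ) :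
    ∃ B : ℝ, ∀ w : Fin n → ℂ, ‖w‖ ≤ M → ∀ t : ℂ, MvPolynomial.eval (w + t • a) q = 0 → ‖t‖ ≤ B := by
  have hc : Continuous fun x : Fin n → ℂ => MvPolynomial.eval x q := MvPolynomial.continuous_eval q
  have hev := hc.continuousAt.eventually_ne ha
  obtain ⟨δ, hδ, hball⟩ := Metric.eventually_nhds_iff.1 hev
  refine ⟨max 0 M / δ, fun w hw t ht => ?_⟩
  by_contra! hlt
  have ht0 : 0 < ‖t‖ := lt_of_le_of_lt (by positivity) hlt
  have htne : t ≠ 0 := norm_pos_iff.1 ht0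
  refine @hball (a + t⁻¹ • w) ?_ ?_
  · rw [dist_eq_norm, add_sub_cancel_left, norm_smul, norm_inv, inv_mul_lt_iff₀ ht0]
    rw [div_lt_iff₀ hδ] at hlt
    exact (hw.trans (le_max_right _ _)).trans_lt hlt
  · have : w + t • a = t • (a + t⁻¹ • w) := by
      rw [smul_add, smul_smul, mul_inv_cancel₀ htne, one_smul, add_comm]
    rw [this, eval_smul_of_isHomogeneous hq] at ht
    exact (mul_eq_zero.1 ht).resolve_left (pow_ne_zero _ htne)

/-- Roots that never meet the imaginary axis stay in the open left half-plane. -/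
theorem eval_ne_zero_of_deformation {a : Fin n → ℂ} (ha : MvPolynomial.eval a q ≠ 0)
    {w : unitInterval → Fin n → ℂ} (hw : Continuous w)
    (hboundary : ∀ s, ∀ t : ℂ, t.re = 0 → MvPolynomial.eval (w s + t • a) q ≠ 0)
    (h0 : ∀ t : ℂ, 0 ≤ t.re → MvPolynomial.eval (w 0 + t • a) q ≠ 0) (t : ℂ) (ht : 0 ≤ t.re) :
    MvPolynomial.eval (w 1 + t • a) q ≠ 0 := by
  set T : Set unitInterval :=
    {s | ∀ t : ℂ, 0 ≤ t.re → MvPolynomial.eval (w s + t • a) q ≠ 0} with hT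
  have hc : Continuous fun x : Fin n → ℂ => MvPolynomial.eval x q := MvPolynomial.continuous_eval q
  -- For `t.re > 0` nonvanishing is equivalent to a closed condition, the uniform lower bound; on
  -- the imaginary axis it is `hboundary`.
  have hclosed : IsClosed T := by
    have : T = ⋂ t : {t : ℂ // 0 ≤ t.re}, {s | ‖MvPolynomial.eval a q‖ * t.1.re ^ d ≤
        ‖MvPolynomial.eval (w s + t.1 • a) q‖} := by
      ext s
      simp only [Set.mem_iInter, Set.mem_ofPred_eq, Subtype.forall, hT]
      refine ⟨fun h t ht => norm_mul_re_pow_le_norm_eval hq h ht, fun h t ht => ?_⟩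
      rcases ht.eq_or_lt with ht0 | ht0
      · exact hboundary s t ht0.symm
      · refine norm_pos_iff.1 (lt_of_lt_of_le ?_ (h t ht))
        have := norm_pos_iff.2 ha
        positivity
    rw [this]
    refine isClosed_iInter fun t => isClosed_le continuous_const ?_
    exact (hc.comp (hw.add continuous_const)).norm
  -- The roots are bounded uniformly in `s`, so the complement of `T` is the projection of a compact
  -- set.
  have hopen : IsOpen T := by
    obtain ⟨M, hM⟩ := (isCompact_range hw).isBounded.exists_norm_le
    obtain ⟨B, hB⟩ := exists_bound_of_eval_eq_zero hq ha M
    have hbad : Tᶜ = Prod.fst '' ({x : unitInterval × ℂ | 0 ≤ x.2.re ∧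
        MvPolynomial.eval (w x.1 + x.2 • a) q = 0} ∩ Set.univ ×ˢ Metric.closedBall (0 : ℂ) B) := by
      ext s
      simp only [hT, Set.mem_compl_iff, Set.mem_ofPred_eq, not_forall, not_not, Set.mem_image,
        Set.mem_inter_iff, Prod.exists, Set.mem_prod, Set.mem_univ, true_and,
        mem_closedBall_zero_iff]
      constructor
      · rintro ⟨t, h1, h2⟩
        exact ⟨s, t, ⟨⟨h1, h2⟩, hB _ (hM _ ⟨s, rfl⟩) _ h2⟩, rfl⟩
      · rintro ⟨s', t, ⟨⟨h1, h2⟩, -⟩, rfl⟩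
        exact ⟨t, h1, h2⟩
    rw [← isClosed_compl_iff, hbad]
    refine IsCompact.isClosed (IsCompact.image ?_ continuous_fst)
    refine IsCompact.inter_left (isCompact_univ.prod (isCompact_closedBall _ _)) ?_
    refine IsClosed.and (isClosed_le continuous_const (Complex.continuous_re.comp continuous_snd))
      (isClosed_eq (hc.comp ?_) continuous_const)
    exact (hw.comp continuous_fst).add (continuous_snd.smul continuous_const)
  have huniv : T = Set.univ := IsClopen.eq_univ ⟨hclosed, hopen⟩ ⟨0, h0⟩
  have h1 : (1 : unitInterval) ∈ T := huniv ▸ Set.mem_univ _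
  exact h1 t ht

end HalfPlane

end Hyperbolic

/-! ### Gårding's theorem: change of hyperbolic direction. -/

namespace Hyperbolic

open Polynomial

variable {n d : ℕ} {p : MvPolynomial (Fin n) ℝ} {e : Fin n → ℝ}

/-- The inclusion of `ℝⁿ` in `ℂⁿ`. -/
def complexify (x : Fin n → ℝ) : Fin n → ℂ := fun i => (x i : ℂ)

theorem complexify_add (x y : Fin n → ℝ) :
    complexify (x + y) = complexify x + complexify y := by
  ext i; simp [complexify]

theorem complexify_smul (c : ℝ) (x : Fin n → ℝ) :
    complexify (c • x) = (c : ℂ) • complexify x := by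
  ext i; simp [complexify]

theorem complexify_neg (x : Fin n → ℝ) : complexify (-x) = -complexify x := by
  ext i; simp [complexify]

theorem continuous_complexify : Continuous (complexify : (Fin n → ℝ) → Fin n → ℂ) :=
  continuous_pi fun i => Complex.continuous_ofReal.comp (continuous_apply i)

/-- The evaluation of a real polynomial at a complex point. -/
noncomputable def complexEval (p : MvPolynomial (Fin n) ℝ) (z : Fin n → ℂ) : ℂ :=
  MvPolynomial.eval z (p.map Complex.ofRealHom)

theorem complexEval_complexify (p : MvPolynomial (Fin n) ℝ) (x : Fin n → ℝ) :
    complexEval p (complexify x) = (MvPolynomial.eval x p : ℂ) := by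
  rw [complexEval, MvPolynomial.eval_map]
  exact (MvPolynomial.eval₂_comp_left Complex.ofRealHom (RingHom.id ℝ) x p).symm

theorem aeval_charPoly (p : MvPolynomial (Fin n) ℝ) (e x : Fin n → ℝ) (z : ℂ) :
    aeval z (charPoly p e x) = complexEval p (z • complexify e - complexify x) := by
  unfold charPoly complexEval
  rw [MvPolynomial.eval_map, MvPolynomial.aeval_def, ← AlgHom.coe_toRingHom,
    MvPolynomial.hom_eval₂]
  congr 1
  · ext
    simp
  · funext i
    simp [complexify]
    ring

theorem complexEval_smul (hp : p.IsHomogeneous d) (c : ℂ) (z : Fin n → ℂ) :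
    complexEval p (c • z) = c ^ d * complexEval p z :=
  eval_smul_of_isHomogeneous (hp.map _) c z

theorem continuous_complexEval (p : MvPolynomial (Fin n) ℝ) : Continuous (complexEval p) :=
  MvPolynomial.continuous_eval _

/-- The set of points all of whose eigenvalues are positive. -/
def openCone (p : MvPolynomial (Fin n) ℝ) (e : Fin n → ℝ) : Set (Fin n → ℝ) :=
  {a | ∀ t : ℝ, 0 ≤ t → MvPolynomial.eval (a + t • e) p ≠ 0}

namespace IsHyperbolic

section Basic

variable (hp : IsHyperbolic p e d)
include hp

theorem complexEval_ne_zero (x : Fin n → ℝ) {z : ℂ} (hz : z.im ≠ 0) :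
    complexEval p (complexify x + z • complexify e) ≠ 0 := fun h => hz <| by
  refine hp.real_roots (-x) z ?_
  rw [aeval_charPoly, complexify_neg, sub_neg_eq_add, add_comm, h]

theorem splits_charPoly (x : Fin n → ℝ) : (charPoly p e x).Splits := by
  refine Splits.of_splits_map (algebraMap ℝ ℂ) (IsAlgClosed.splits _) fun z hz => ?_
  have h0 : aeval z (charPoly p e x) = 0 := by
    have := (mem_roots'.1 hz).2
    rwa [IsRoot, eval_map_algebraMap] at this
  exact ⟨z.re, Complex.ext (by simp) (by simp [hp.real_roots x z h0])⟩

theorem card_eigenvalues (x : Fin n → ℝ) : (eigenvalues p e x).card = d := by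
  rw [eigenvalues, ← (hp.splits_charPoly x).natDegree_eq_card_roots]
  exact natDegree_linePoly hp.homogeneous x hp.eval_pos.ne'

theorem eval_add_smul (x : Fin n → ℝ) (t : ℝ) :
    MvPolynomial.eval (x + t • e) p =
      MvPolynomial.eval e p * ((eigenvalues p e x).map fun r => t + r).prod := by
  have h1 : x + t • e = (-1 : ℝ) • ((-t) • e - x) := by
    simp only [smul_sub, neg_smul, one_smul, neg_neg, sub_neg_eq_add, add_comm]
  have hlead : (charPoly p e x).leadingCoeff = MvPolynomial.eval e p :=
    leadingCoeff_linePoly hp.homogeneous x hp.eval_pos.ne'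
  rw [h1, eval_smul_of_isHomogeneous hp.homogeneous, ← eval_charPoly,
    (hp.splits_charPoly x).eval_eq_prod_roots, hlead, mul_left_comm]
  congr 1
  have h2 := hp.card_eigenvalues x
  rw [← h2, eigenvalues]
  generalize (charPoly p e x).roots = s
  induction s using Multiset.induction_on with
  | empty => simp
  | cons r s ih =>
    rw [Multiset.card_cons, pow_succ, Multiset.map_cons, Multiset.prod_cons, Multiset.map_cons,
      Multiset.prod_cons, ← ih]
    ring

theorem mem_eigenvalues_iff (x : Fin n → ℝ) (r : ℝ) :
    r ∈ eigenvalues p e x ↔ MvPolynomial.eval (x + (-r) • e) p = 0 := by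
  rw [hp.eval_add_smul, mul_eq_zero, or_iff_right hp.eval_pos.ne', Multiset.prod_eq_zero_iff,
    Multiset.mem_map]
  constructor
  · exact fun h => ⟨r, h, by ring⟩
  · rintro ⟨r', h, h'⟩
    rwa [show r = r' by linarith]

theorem mem_cone_iff {x : Fin n → ℝ} :
    x ∈ cone p e ↔ ∀ t : ℝ, 0 < t → MvPolynomial.eval (x + t • e) p ≠ 0 := by
  constructor
  · intro h t ht h0
    have := h (-t) ((hp.mem_eigenvalues_iff x _).2 (by rwa [neg_neg]))
    linarith
  · intro h r hr
    by_contra! hr0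
    exact h (-r) (by linarith) ((hp.mem_eigenvalues_iff x r).1 hr)

theorem add_smul_mem_openCone {x : Fin n → ℝ} (hx : x ∈ cone p e) {t : ℝ} (ht : 0 < t) :
    x + t • e ∈ openCone p e := fun s hs => by
  rw [add_assoc, ← add_smul]
  exact hp.mem_cone_iff.1 hx _ (by linarith)

theorem eigenvalues_pos {a : Fin n → ℝ} (ha : a ∈ openCone p e) {r : ℝ}
    (hr : r ∈ eigenvalues p e a) : 0 < r := by
  by_contra! hr0
  exact ha (-r) (by linarith) ((hp.mem_eigenvalues_iff a r).1 hr)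

theorem eval_pos_of_mem_openCone {a : Fin n → ℝ} (ha : a ∈ openCone p e) :
    0 < MvPolynomial.eval a p := by
  have h := hp.eval_add_smul a 0
  rw [zero_smul, add_zero] at h
  rw [h]
  refine mul_pos hp.eval_pos (Multiset.prod_pos ?_)
  intro s hs
  obtain ⟨r, hr, rfl⟩ := Multiset.mem_map.1 hs
  simpa using hp.eigenvalues_pos ha hr

/-- For `τ ≠ 0`, homogeneity reduces to `a + (α / τ) e`, where `α / τ` has nonnegative real part. If
it is real, use `a ∈ openCone p e`; otherwise use hyperbolicity. -/
theorem complexEval_ne_zero_of_mem_openCone {a : Fin n → ℝ} (ha : a ∈ openCone p e) {α : ℝ}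
    (hα : 0 < α) {τ : ℂ} (hτ : 0 ≤ τ.re) :
    complexEval p ((α : ℂ) • complexify e + τ • complexify a) ≠ 0 := by
  have hα' : (α : ℂ) ≠ 0 := by exact_mod_cast hα.ne'
  by_cases h0 : τ = 0
  · rw [h0, zero_smul, add_zero, complexEval_smul hp.homogeneous, complexEval_complexify]
    exact mul_ne_zero (pow_ne_zero _ hα') (by exact_mod_cast hp.eval_pos.ne')
  · have h1 : (α : ℂ) • complexify e + τ • complexify a =
        τ • (complexify a + (α / τ) • complexify e) := by
      rw [smul_add, smul_smul, mul_div_cancel₀ _ h0, add_comm]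
    rw [h1, complexEval_smul hp.homogeneous]
    refine mul_ne_zero (pow_ne_zero _ h0) ?_
    by_cases him : ((α : ℂ) / τ).im = 0
    · have hre : ((α : ℂ) / τ) = (((α : ℂ) / τ).re : ℂ) := Complex.ext (by simp) (by simp [him])
      have hnn : 0 ≤ ((α : ℂ) / τ).re := by
        rw [Complex.div_re]
        simp only [Complex.ofReal_re, Complex.ofReal_im, zero_mul, zero_div, add_zero]
        exact div_nonneg (mul_nonneg hα.le hτ) (Complex.normSq_nonneg _)
      rw [hre, ← complexify_smul, ← complexify_add, complexEval_complexify]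
      exact_mod_cast ha _ hnn
    · exact hp.complexEval_ne_zero a him

end Basic

section Change

variable (hp : IsHyperbolic p e d) {a : Fin n → ℝ} (ha : a ∈ openCone p e)
include hp ha

/-- Deform `x` to `0` through `s x`. When `τ.re = 0` the coefficient `τ i` of `a` is real, so the
point is a real vector plus `i α e` and hyperbolicity applies. The term `i α e` is what keeps roots
off the boundary. -/
theorem complexEval_upper_ne_zero (x : Fin n → ℝ) {α : ℝ} (hα : 0 < α) {τ : ℂ} (hτ : 0 ≤ τ.re) :
    complexEval p (complexify x + ((α : ℂ) * Complex.I) • complexify e +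
      τ • (Complex.I • complexify a)) ≠ 0 := by
  have hpC := hp.homogeneous.map Complex.ofRealHom
  have hane : complexEval p (Complex.I • complexify a) ≠ 0 := by
    rw [complexEval_smul hp.homogeneous, complexEval_complexify]
    exact mul_ne_zero (pow_ne_zero _ Complex.I_ne_zero)
      (by exact_mod_cast (hp.eval_pos_of_mem_openCone ha).ne')
  have key := eval_ne_zero_of_deformation hpC (a := Complex.I • complexify a) hane
    (w := fun s => ((s : ℝ) : ℂ) • complexify x + ((α : ℂ) * Complex.I) • complexify e)
    (by fun_prop) ?_ ?_ τ hτ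
  · simpa [complexEval] using key
  · intro s t ht
    have ht' : t * Complex.I = ((-t.im : ℝ) : ℂ) := Complex.ext (by simp) (by simp [ht])
    have := hp.complexEval_ne_zero ((s : ℝ) • x + (-t.im) • a) (z := (α : ℂ) * Complex.I)
      (by simpa using hα.ne')
    rw [complexify_add, complexify_smul, complexify_smul, ← ht'] at this
    rw [smul_smul]
    change complexEval p _ ≠ 0
    convert this using 2
    abel
  · intro t ht
    have := hp.complexEval_ne_zero_of_mem_openCone ha hα ht
    have h2 := mul_ne_zero (pow_ne_zero d Complex.I_ne_zero) this
    rw [← complexEval_smul hp.homogeneous] at h2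
    change complexEval p _ ≠ 0
    convert h2 using 2
    simp only [Set.Icc.coe_zero, Complex.ofReal_zero, zero_smul, zero_add, smul_add, smul_smul,
      mul_comm]

/-- Write `z = τ i` and let `α` tend to `0`: the lower bound for the norm does not depend on `α`. -/
theorem complexEval_ne_zero_of_im_pos (x : Fin n → ℝ) {z : ℂ} (hz : 0 < z.im) :
    complexEval p (complexify x + z • complexify a) ≠ 0 := by
  have hpC := hp.homogeneous.map Complex.ofRealHom
  set τ : ℂ := -Complex.I * z with hτdef
  have hτ : τ.re = z.im := by simp [hτdef]
  have hτz : τ * Complex.I = z := by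
    rw [hτdef, mul_right_comm, neg_mul, Complex.I_mul_I, neg_neg, one_mul]
  have hbound : ∀ α : ℝ, 0 < α → ‖complexEval p (Complex.I • complexify a)‖ * τ.re ^ d ≤
      ‖complexEval p (complexify x + ((α : ℂ) * Complex.I) • complexify e +
        τ • (Complex.I • complexify a))‖ := fun α hα =>
    norm_mul_re_pow_le_norm_eval hpC
      (fun t ht => hp.complexEval_upper_ne_zero ha x hα ht) (hτ ▸ hz.le)
  have hcont : Continuous fun α : ℝ => ‖complexEval p (complexify x +
      ((α : ℂ) * Complex.I) • complexify e + τ • (Complex.I • complexify a))‖ := by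
    refine ((continuous_complexEval p).comp ?_).norm
    fun_prop
  have hlim := (hcont.tendsto 0).mono_left (nhdsWithin_le_nhds (s := Set.Ioi 0))
  have hle := ge_of_tendsto hlim (eventually_nhdsWithin_of_forall fun α hα => hbound α hα)
  simp only [Complex.ofReal_zero, zero_mul, zero_smul, add_zero, smul_smul, hτz] at hle
  refine norm_pos_iff.1 (lt_of_lt_of_le ?_ hle)
  refine mul_pos (norm_pos_iff.2 ?_) (pow_pos (hτ ▸ hz) _)
  rw [complexEval_smul hp.homogeneous, complexEval_complexify]
  exact mul_ne_zero (pow_ne_zero _ Complex.I_ne_zero)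
    (by exact_mod_cast (hp.eval_pos_of_mem_openCone ha).ne')

/-- Gårding: `p` is hyperbolic with respect to every point of its open hyperbolicity cone. -/
theorem of_mem_openCone : IsHyperbolic p a d where
  homogeneous := hp.homogeneous
  eval_pos := hp.eval_pos_of_mem_openCone ha
  real_roots x z hz := by
    rw [aeval_charPoly] at hz
    rcases lt_trichotomy z.im 0 with h | h | h
    · exfalso
      refine hp.complexEval_ne_zero_of_im_pos ha x (z := -z) (by simpa using h) ?_
      have : complexify x + (-z) • complexify a = (-1 : ℂ) • (z • complexify a - complexify x) := by
        simp [add_comm, sub_eq_add_neg]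
      rw [this, complexEval_smul hp.homogeneous, hz, mul_zero]
    · exact h
    · exfalso
      refine hp.complexEval_ne_zero_of_im_pos ha (-x) h ?_
      rw [complexify_neg, neg_add_eq_sub, hz]

/-- Deform along the segment from `e` to `y`. A nonzero imaginary `τ` is excluded by hyperbolicity
in direction `a`, and `τ = 0` because the segment avoids the zeros of `p`. -/
theorem complexEval_ne_zero_of_re_nonneg {y : Fin n → ℝ} (hy : y ∈ openCone p e) {τ : ℂ}
    (hτ : 0 ≤ τ.re) : complexEval p (complexify y + τ • complexify a) ≠ 0 := by
  have hpC := hp.homogeneous.map Complex.ofRealHom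
  have hane : complexEval p (complexify a) ≠ 0 := by
    rw [complexEval_complexify]
    exact_mod_cast (hp.eval_pos_of_mem_openCone ha).ne'
  have key := eval_ne_zero_of_deformation hpC (a := complexify a) hane
    (w := fun s => complexify ((s : ℝ) • y + (1 - (s : ℝ)) • e))
    (continuous_complexify.comp (by fun_prop)) ?_ ?_ τ hτ
  · simpa [complexEval] using key
  · intro s t ht
    by_cases him : t.im = 0
    · have ht0 : t = 0 := Complex.ext ht him
      rw [ht0, zero_smul, add_zero]
      have : complexEval p (complexify ((s : ℝ) • y + (1 - (s : ℝ)) • e)) ≠ 0 := by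
        rw [complexEval_complexify]
        have hs0 := s.2.1
        rcases hs0.eq_or_lt with h0 | h0
        · rw [← h0]
          simpa using hp.eval_pos.ne'
        · have h1 : (s : ℝ) • y + (1 - (s : ℝ)) • e =
              (s : ℝ) • (y + ((1 - (s : ℝ)) / s) • e) := by
            rw [smul_add, smul_smul, mul_div_cancel₀ _ h0.ne']
          rw [h1, eval_smul_of_isHomogeneous hp.homogeneous]
          exact_mod_cast mul_ne_zero (pow_ne_zero _ h0.ne')
            (hy _ (div_nonneg (by linarith [s.2.2]) h0.le))
      exact this
    · exact (hp.of_mem_openCone ha).complexEval_ne_zero _ him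
  · intro t ht
    have := hp.complexEval_ne_zero_of_mem_openCone ha one_pos ht
    simpa [complexEval] using this

/-- Gårding: the hyperbolicity cone does not shrink when the direction changes. -/
theorem cone_subset_cone : cone p e ⊆ cone p a := by
  intro y hy
  have hpC := hp.homogeneous.map Complex.ofRealHom
  rw [(hp.of_mem_openCone ha).mem_cone_iff]
  intro t ht h0
  -- The shift by `ε e` moves `y` into the open cone; the bound is uniform in `ε`, which then tends
  -- to `0`.
  have hbound : ∀ ε : ℝ, 0 < ε → ‖complexEval p (complexify a)‖ * (t : ℂ).re ^ d ≤
      ‖complexEval p (complexify (y + ε • e) + (t : ℂ) • complexify a)‖ := fun ε hε =>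
    norm_mul_re_pow_le_norm_eval hpC (fun τ hτ =>
      hp.complexEval_ne_zero_of_re_nonneg ha (hp.add_smul_mem_openCone hy hε) hτ) ht.le
  have hcont : Continuous fun ε : ℝ =>
      ‖complexEval p (complexify (y + ε • e) + (t : ℂ) • complexify a)‖ := by
    refine ((continuous_complexEval p).comp ?_).norm
    exact (continuous_complexify.comp (by fun_prop)).add continuous_const
  have hlim := (hcont.tendsto 0).mono_left (nhdsWithin_le_nhds (s := Set.Ioi 0))
  have hle := ge_of_tendsto hlim (eventually_nhdsWithin_of_forall fun α hα => hbound α hα)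
  rw [zero_smul, add_zero, ← complexify_smul, ← complexify_add, complexEval_complexify,
    complexEval_complexify, h0] at hle
  simp only [Complex.ofReal_re, Complex.ofReal_zero, norm_zero] at hle
  have hpos : 0 < ‖((MvPolynomial.eval a p : ℝ) : ℂ)‖ :=
    norm_pos_iff.2 (by exact_mod_cast (hp.eval_pos_of_mem_openCone ha).ne')
  have := mul_pos hpos (pow_pos ht d)
  linarith

end Change

end IsHyperbolic

end Hyperbolic

namespace Hyperbolic

/-! ### Estimates for products of shifted nonnegative numbers. -/

section Multiset

variable {s : Multiset ℝ} (hs : ∀ r ∈ s, 0 ≤ r)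
include hs

theorem one_le_prod_one_add : 1 ≤ (s.map fun r => 1 + r).prod := by
  induction s using Multiset.induction_on with
  | empty => simp
  | cons r s ih =>
    rw [Multiset.map_cons, Multiset.prod_cons]
    have h1 := hs r (Multiset.mem_cons_self r s)
    exact one_le_mul_of_one_le_of_one_le (by linarith)
      (ih fun r' hr' => hs r' (Multiset.mem_cons_of_mem hr'))

theorem one_add_le_prod_one_add {r : ℝ} (hr : r ∈ s) :
    1 + r ≤ (s.map fun r => 1 + r).prod := by
  obtain ⟨s', rfl⟩ := Multiset.exists_cons_of_mem hr
  rw [Multiset.map_cons, Multiset.prod_cons]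
  have h1 := hs r hr
  exact le_mul_of_one_le_right (by linarith)
    (one_le_prod_one_add fun r' hr' => hs r' (Multiset.mem_cons_of_mem hr'))

theorem prod_one_add_le {B : ℝ} (hB : ∀ r ∈ s, r ≤ B) :
    (s.map fun r => 1 + r).prod ≤ (1 + B) ^ (s.filter fun r => r ≠ 0).card := by
  induction s using Multiset.induction_on with
  | empty => simp
  | cons r s ih =>
    have h1 := hs r (Multiset.mem_cons_self r s)
    have h2 := hB r (Multiset.mem_cons_self r s)
    have hs' : ∀ r ∈ s, 0 ≤ r := fun r' hr' => hs r' (Multiset.mem_cons_of_mem hr')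
    have h3 := ih hs' fun r' hr' => hB r' (Multiset.mem_cons_of_mem hr')
    rw [Multiset.map_cons, Multiset.prod_cons]
    by_cases hr : r = 0
    · rw [Multiset.filter_cons_of_neg (p := fun r : ℝ => r ≠ 0) s (by simpa using hr), hr, add_zero, one_mul]
      exact h3
    · rw [Multiset.filter_cons_of_pos (p := fun r : ℝ => r ≠ 0) s hr, Multiset.card_cons, pow_succ']
      exact mul_le_mul (by linarith) h3 (zero_le_one.trans (one_le_prod_one_add hs'))
        (by linarith)

theorem prod_add_nonneg {t : ℝ} (ht : 0 ≤ t) : 0 ≤ (s.map fun r => t + r).prod := by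
  refine Multiset.prod_nonneg fun a ha => ?_
  obtain ⟨r, hr, rfl⟩ := Multiset.mem_map.1 ha
  exact add_nonneg ht (hs r hr)

theorem prod_mul_add_le {β t : ℝ} (hβ : 1 ≤ β) (ht : 0 ≤ t) :
    (s.map fun r => β * t + r).prod ≤ β ^ s.card * (s.map fun r => t + r).prod := by
  induction s using Multiset.induction_on with
  | empty => simp
  | cons r s ih =>
    have h1 := hs r (Multiset.mem_cons_self r s)
    have hs' : ∀ r ∈ s, 0 ≤ r := fun r' hr' => hs r' (Multiset.mem_cons_of_mem hr')
    rw [Multiset.map_cons, Multiset.prod_cons, Multiset.map_cons, Multiset.prod_cons,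
      Multiset.card_cons, pow_succ', mul_mul_mul_comm]
    exact mul_le_mul (by nlinarith) (ih hs') (prod_add_nonneg hs' (by positivity))
      (by positivity)

/-- Each zero contributes exactly `t` and each positive `r` at least `r`. With the companion upper
bound this fixes the order of vanishing at `t = 0`. -/
theorem exists_mul_pow_count_le_prod :
    ∃ c : ℝ, 0 < c ∧ ∀ t : ℝ, 0 < t → c * t ^ s.count 0 ≤ (s.map fun r => t + r).prod := by
  induction s using Multiset.induction_on with
  | empty => exact ⟨1, one_pos, by simp⟩
  | cons r s ih =>
    have h1 := hs r (Multiset.mem_cons_self r s)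
    have hs' : ∀ r ∈ s, 0 ≤ r := fun r' hr' => hs r' (Multiset.mem_cons_of_mem hr')
    obtain ⟨c, hc, h⟩ := ih hs'
    by_cases hr : r = 0
    · subst hr
      refine ⟨c, hc, fun t ht => ?_⟩
      rw [Multiset.map_cons, Multiset.prod_cons, Multiset.count_cons_self, pow_succ', add_zero,
        mul_left_comm]
      exact mul_le_mul_of_nonneg_left (h t ht) ht.le
    · have hr' : 0 < r := lt_of_le_of_ne h1 (Ne.symm hr)
      refine ⟨r * c, mul_pos hr' hc, fun t ht => ?_⟩
      rw [Multiset.map_cons, Multiset.prod_cons, Multiset.count_cons_of_ne (Ne.symm hr), mul_assoc]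
      exact mul_le_mul (by linarith) (h t ht) (by positivity) (by positivity)

theorem exists_prod_le_mul_pow_count :
    ∃ C : ℝ, 0 < C ∧ ∀ t : ℝ, 0 < t → t ≤ 1 →
      (s.map fun r => t + r).prod ≤ C * t ^ s.count 0 := by
  induction s using Multiset.induction_on with
  | empty => exact ⟨1, one_pos, by simp⟩
  | cons r s ih =>
    have h1 := hs r (Multiset.mem_cons_self r s)
    have hs' : ∀ r ∈ s, 0 ≤ r := fun r' hr' => hs r' (Multiset.mem_cons_of_mem hr')
    obtain ⟨C, hC, h⟩ := ih hs'
    by_cases hr : r = 0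
    · subst hr
      refine ⟨C, hC, fun t ht ht1 => ?_⟩
      rw [Multiset.map_cons, Multiset.prod_cons, Multiset.count_cons_self, pow_succ', add_zero,
        mul_left_comm]
      exact mul_le_mul_of_nonneg_left (h t ht ht1) ht.le
    · refine ⟨(1 + r) * C, by positivity, fun t ht ht1 => ?_⟩
      rw [Multiset.map_cons, Multiset.prod_cons, Multiset.count_cons_of_ne (Ne.symm hr), mul_assoc]
      exact mul_le_mul (by linarith) (h t ht ht1) (prod_add_nonneg hs' ht.le) (by positivity)

end Multiset

/-! ### Convexity of the cone and growth estimates for the rank. -/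

variable {n d : ℕ} {p : MvPolynomial (Fin n) ℝ} {e : Fin n → ℝ}

/-- The multiplicity of `0` as a hyperbolic eigenvalue. -/
noncomputable def nullity (p : MvPolynomial (Fin n) ℝ) (e x : Fin n → ℝ) : ℕ :=
  (eigenvalues p e x).count 0

namespace IsHyperbolic

variable (hp : IsHyperbolic p e d)
include hp

theorem nullity_add_rank (x : Fin n → ℝ) : nullity p e x + rank p e x = d := by
  rw [← hp.card_eigenvalues x, nullity, rank, Multiset.count_eq_card_filter_eq,
    ← Multiset.card_add]
  conv_rhs => rw [← Multiset.filter_add_not (fun t => (0 : ℝ) = t) (eigenvalues p e x)]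
  simp only [ne_eq, eq_comm]

theorem rank_le (x : Fin n → ℝ) : rank p e x ≤ d := by
  have := hp.nullity_add_rank x
  omega

theorem smul_mem_cone {x : Fin n → ℝ} (hx : x ∈ cone p e) {c : ℝ} (hc : 0 ≤ c) :
    c • x ∈ cone p e := by
  rw [hp.mem_cone_iff]
  intro t ht
  rcases hc.eq_or_lt with h0 | h0
  · rw [← h0, zero_smul, zero_add, eval_smul_of_isHomogeneous hp.homogeneous]
    exact mul_ne_zero (pow_ne_zero _ ht.ne') hp.eval_pos.ne'
  · have : c • x + t • e = c • (x + (t / c) • e) := by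
      rw [smul_add, smul_smul, mul_div_cancel₀ _ h0.ne']
    rw [this, eval_smul_of_isHomogeneous hp.homogeneous]
    exact mul_ne_zero (pow_ne_zero _ h0.ne') (hp.mem_cone_iff.1 hx _ (by positivity))

theorem add_mem_cone {x y : Fin n → ℝ} (hx : x ∈ cone p e) (hy : y ∈ cone p e) :
    x + y ∈ cone p e := by
  rw [hp.mem_cone_iff]
  intro t ht
  have ha := hp.add_smul_mem_openCone hx ht
  have := (hp.of_mem_openCone ha).mem_cone_iff.1 (hp.cone_subset_cone ha hy) 1 one_pos
  rw [one_smul] at this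
  convert this using 2
  abel_nf

/-- Nonnegative eigenvalues give `p(x + t e) ≥ p(e) t ^ d` for all `t > 0`; conversely this closed
condition rules out a negative eigenvalue. -/
theorem isClosed_cone : IsClosed (cone p e) := by
  have : cone p e = ⋂ t : {t : ℝ // 0 < t}, {x | MvPolynomial.eval e p * t.1 ^ d ≤
      MvPolynomial.eval (x + t.1 • e) p} := by
    ext x
    rw [Set.mem_iInter, Subtype.forall]
    constructor
    · intro hx t ht
      change MvPolynomial.eval e p * t ^ d ≤ MvPolynomial.eval (x + t • e) p
      rw [hp.eval_add_smul]
      refine mul_le_mul_of_nonneg_left ?_ hp.eval_pos.le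
      have hs : ∀ r ∈ eigenvalues p e x, 0 ≤ r := hx
      rw [← hp.card_eigenvalues x, ← Multiset.prod_replicate, ← Multiset.map_const']
      exact Multiset.prod_map_le_prod_map₀ _ _ (fun _ _ => ht.le)
        fun r hr => le_add_of_nonneg_right (hs r hr)
    · intro h
      rw [hp.mem_cone_iff]
      intro t ht
      have := h t ht
      have h2 := mul_pos hp.eval_pos (pow_pos ht d)
      exact (lt_of_lt_of_le h2 this).ne'
  rw [this]
  refine isClosed_iInter fun t => isClosed_le continuous_const ?_
  exact (MvPolynomial.continuous_eval p).comp (by fun_prop)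

theorem exists_smul_sub_mem_cone (x : Fin n → ℝ) : ∃ C : ℝ, 0 < C ∧ C • e - x ∈ cone p e := by
  obtain ⟨C, hC⟩ := (eigenvalues p e x).toFinset.bddAbove
  refine ⟨max C 1, by positivity, ?_⟩
  rw [hp.mem_cone_iff]
  intro t ht h0
  have h1 : max C 1 • e - x + t • e = (-1 : ℝ) • (x + (-(max C 1 + t)) • e) := by
    module
  rw [h1, eval_smul_of_isHomogeneous hp.homogeneous] at h0
  have h2 := (hp.mem_eigenvalues_iff x (max C 1 + t)).2
    ((mul_eq_zero.1 h0).resolve_left (pow_ne_zero _ (by norm_num)))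
  have h3 := hC (Finset.mem_coe.2 (Multiset.mem_toFinset.2 h2))
  linarith [le_max_left C 1]

theorem self_mem_cone : e ∈ cone p e := by
  rw [hp.mem_cone_iff]
  intro t ht
  have : e + t • e = (1 + t) • e := by module
  rw [this, eval_smul_of_isHomogeneous hp.homogeneous]
  exact mul_ne_zero (pow_ne_zero _ (by positivity)) hp.eval_pos.ne'

theorem zero_mem_cone : (0 : Fin n → ℝ) ∈ cone p e := by
  simpa using hp.smul_mem_cone hp.self_mem_cone le_rfl

theorem eval_le_eval_add {z y : Fin n → ℝ} (hz : z ∈ openCone p e) (hy : y ∈ cone p e) :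
    MvPolynomial.eval z p ≤ MvPolynomial.eval (y + z) p := by
  have h := (hp.of_mem_openCone hz).eval_add_smul y 1
  rw [one_smul] at h
  rw [h]
  exact le_mul_of_one_le_right (hp.eval_pos_of_mem_openCone hz).le
    (one_le_prod_one_add (hp.cone_subset_cone hz hy))

/-- A zero of `p` on the half-line `z - s y` forces growth of `p` between `z` and `z + y`. -/
theorem mul_one_add_inv_le_eval_add {z y : Fin n → ℝ} (hz : z ∈ openCone p e)
    (hy : y ∈ cone p e) {s : ℝ} (hs : 0 < s) (h0 : MvPolynomial.eval (z - s • y) p = 0) :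
    MvPolynomial.eval z p * (1 + s⁻¹) ≤ MvPolynomial.eval (y + z) p := by
  have hpz := hp.of_mem_openCone hz
  have h := hpz.eval_add_smul y 1
  rw [one_smul] at h
  rw [h]
  refine mul_le_mul_of_nonneg_left ?_ (hp.eval_pos_of_mem_openCone hz).le
  refine one_add_le_prod_one_add (hp.cone_subset_cone hz hy) ?_
  rw [hpz.mem_eigenvalues_iff]
  have : y + (-s⁻¹) • z = (-s⁻¹) • (z - s • y) := by
    rw [smul_sub, smul_smul, neg_mul, inv_mul_cancel₀ hs.ne']
    module
  rw [this, eval_smul_of_isHomogeneous hp.homogeneous, h0, mul_zero]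

theorem eval_mul_add_smul_le {x : Fin n → ℝ} (hx : x ∈ cone p e) {β t : ℝ} (hβ : 1 ≤ β)
    (ht : 0 ≤ t) : MvPolynomial.eval (x + (β * t) • e) p ≤
      β ^ d * MvPolynomial.eval (x + t • e) p := by
  rw [hp.eval_add_smul, hp.eval_add_smul, mul_left_comm]
  refine mul_le_mul_of_nonneg_left ?_ hp.eval_pos.le
  have := prod_mul_add_le (s := eigenvalues p e x) hx hβ ht
  rwa [hp.card_eigenvalues] at this

theorem exists_mul_pow_nullity_le {x : Fin n → ℝ} (hx : x ∈ cone p e) :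
    ∃ c : ℝ, 0 < c ∧ ∀ t : ℝ, 0 < t → c * t ^ nullity p e x ≤ MvPolynomial.eval (x + t • e) p := by
  obtain ⟨c, hc, h⟩ := exists_mul_pow_count_le_prod (s := eigenvalues p e x) hx
  refine ⟨MvPolynomial.eval e p * c, mul_pos hp.eval_pos hc, fun t ht => ?_⟩
  rw [hp.eval_add_smul, mul_assoc]
  exact mul_le_mul_of_nonneg_left (h t ht) hp.eval_pos.le

theorem exists_le_mul_pow_nullity {x : Fin n → ℝ} (hx : x ∈ cone p e) :
    ∃ C : ℝ, 0 < C ∧ ∀ t : ℝ, 0 < t → t ≤ 1 →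
      MvPolynomial.eval (x + t • e) p ≤ C * t ^ nullity p e x := by
  obtain ⟨C, hC, h⟩ := exists_prod_le_mul_pow_count (s := eigenvalues p e x) hx
  refine ⟨MvPolynomial.eval e p * C, mul_pos hp.eval_pos hC, fun t ht ht1 => ?_⟩
  rw [hp.eval_add_smul, mul_assoc]
  exact mul_le_mul_of_nonneg_left (h t ht ht1) hp.eval_pos.le

/-- Near `0` the value `p(x + t e)` is at least a multiple of `t ^ nullity`, so it cannot be of
smaller order. -/
theorem le_nullity_of_eval_le {x : Fin n → ℝ} (hx : x ∈ cone p e) {k : ℕ} {C δ : ℝ} (hδ : 0 < δ)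
    (h : ∀ t : ℝ, 0 < t → t ≤ δ → MvPolynomial.eval (x + t • e) p ≤ C * t ^ k) :
    k ≤ nullity p e x := by
  obtain ⟨c, hc, hlow⟩ := hp.exists_mul_pow_nullity_le hx
  by_contra! hlt
  obtain ⟨j, rfl⟩ := Nat.exists_eq_add_of_lt hlt
  set m := nullity p e x
  have hC1 : 0 < |C| + 1 := by positivity
  set t := min (min δ 1) (c / (2 * (|C| + 1))) with ht
  have ht0 : 0 < t := by positivity
  have ht1 : t ≤ 1 := (min_le_left _ _).trans (min_le_right _ _)
  have htδ : t ≤ δ := (min_le_left _ _).trans (min_le_left _ _)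
  have htc : t * (2 * (|C| + 1)) ≤ c := (le_div_iff₀ (by positivity)).1 (min_le_right _ _)
  have h1 := (hlow t ht0).trans (h t ht0 htδ)
  have h2 : C * t ^ (m + j + 1) = (C * t ^ (j + 1)) * t ^ m := by ring
  rw [h2] at h1
  have h3 : c ≤ C * t ^ (j + 1) := le_of_mul_le_mul_right h1 (pow_pos ht0 m)
  have h4 : t ^ (j + 1) ≤ t := by
    rw [pow_succ]
    exact mul_le_of_le_one_left ht0.le (pow_le_one₀ ht0.le ht1)
  have h5 : C * t ^ (j + 1) ≤ |C| * t :=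
    mul_le_mul (le_abs_self C) h4 (by positivity) (abs_nonneg C)
  nlinarith [abs_nonneg C]

/-- Monotonicity of `p` gives `p(ε y + ε t e) ≤ p(x + ε t e)`; compare orders of vanishing. -/
theorem rank_le_rank_of_sub_mem {x y : Fin n → ℝ} (hx : x ∈ cone p e) (hy : y ∈ cone p e) {ε : ℝ}
    (hε : 0 < ε) (h : x - ε • y ∈ cone p e) : rank p e y ≤ rank p e x := by
  obtain ⟨C, hC, hup⟩ := hp.exists_le_mul_pow_nullity hx
  suffices hn : nullity p e x ≤ nullity p e y by
    have h1 := hp.nullity_add_rank x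
    have h2 := hp.nullity_add_rank y
    omega
  refine hp.le_nullity_of_eval_le hy (C := C * ε ^ nullity p e x / ε ^ d) (δ := ε⁻¹)
    (by positivity) fun t ht htε => ?_
  have h1 : ε • (y + t • e) = ε • y + (ε * t) • e := by module
  have h2 := hp.eval_le_eval_add
    (hp.add_smul_mem_openCone (hp.smul_mem_cone hy hε.le) (mul_pos hε ht)) h
  rw [← h1, eval_smul_of_isHomogeneous hp.homogeneous, h1] at h2
  have h3 : x - ε • y + (ε • y + (ε * t) • e) = x + (ε * t) • e := by abel
  rw [h3] at h2
  have h4 := h2.trans (hup (ε * t) (mul_pos hε ht) (by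
    calc ε * t ≤ ε * ε⁻¹ := mul_le_mul_of_nonneg_left htε hε.le
      _ = 1 := mul_inv_cancel₀ hε.ne'))
  rw [div_mul_eq_mul_div, le_div_iff₀ (by positivity), mul_comm]
  rw [mul_pow, ← mul_assoc] at h4
  exact h4

/-- A summand that does not raise the rank lies in the minimal face. -/
theorem exists_sub_smul_mem_cone {x y : Fin n → ℝ} (hx : x ∈ cone p e) (hy : y ∈ cone p e)
    (h : rank p e (x + y) ≤ rank p e x) : ∃ ε : ℝ, 0 < ε ∧ x - ε • y ∈ cone p e := by
  have hxy := hp.add_mem_cone hx hy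
  have hn : nullity p e x ≤ nullity p e (x + y) := by
    have h1 := hp.nullity_add_rank x
    have h2 := hp.nullity_add_rank (x + y)
    omega
  obtain ⟨c, hc, hlow⟩ := hp.exists_mul_pow_nullity_le hx
  obtain ⟨C, hC, hup⟩ := hp.exists_le_mul_pow_nullity hxy
  obtain ⟨B, hB, hBy⟩ := hp.exists_smul_sub_mem_cone y
  -- For `t ≤ 1` the orders of vanishing are compared; for `t ≥ 1`, `y` is dominated by `B t e`.
  have hM : ∃ M : ℝ, 0 < M ∧ ∀ t : ℝ, 0 < t →
      MvPolynomial.eval (x + y + t • e) p ≤ M * MvPolynomial.eval (x + t • e) p := by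
    refine ⟨max (C / c) ((1 + B) ^ d), by positivity, fun t ht => ?_⟩
    have hpos := hp.eval_pos_of_mem_openCone (hp.add_smul_mem_openCone hx ht)
    rcases le_total t 1 with ht1 | ht1
    · calc MvPolynomial.eval (x + y + t • e) p ≤ C * t ^ nullity p e (x + y) := hup t ht ht1
        _ ≤ C * t ^ nullity p e x :=
          mul_le_mul_of_nonneg_left (pow_le_pow_of_le_one ht.le ht1 hn) hC.le
        _ = (C / c) * (c * t ^ nullity p e x) := by field_simp
        _ ≤ (C / c) * MvPolynomial.eval (x + t • e) p :=
          mul_le_mul_of_nonneg_left (hlow t ht) (by positivity)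
        _ ≤ _ := mul_le_mul_of_nonneg_right (le_max_left _ _) hpos.le
    · have h1 := hp.eval_le_eval_add (hp.add_smul_mem_openCone hxy ht)
        (hp.add_mem_cone hBy (hp.smul_mem_cone hp.self_mem_cone
          (mul_nonneg hB.le (sub_nonneg.2 ht1))))
      have h2 : B • e - y + (B * (t - 1)) • e + (x + y + t • e) = x + ((1 + B) * t) • e := by
        module
      rw [h2] at h1
      exact (h1.trans (hp.eval_mul_add_smul_le hx (by linarith) ht.le)).trans
        (mul_le_mul_of_nonneg_right (le_max_right _ _) hpos.le)
  obtain ⟨M, hM0, hM⟩ := hM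
  refine ⟨M⁻¹, inv_pos.2 hM0, ?_⟩
  rw [hp.mem_cone_iff]
  intro t ht h0
  have hz := hp.add_smul_mem_openCone hx ht
  -- A zero at `x - M⁻¹ y + t e` would force growth by the factor `1 + M`, contradicting the bound
  -- `M`.
  have h1 := hp.mul_one_add_inv_le_eval_add hz hy (inv_pos.2 hM0) (by
    rw [← h0]; congr 2; abel)
  have h2 := hM t ht
  have hpos := hp.eval_pos_of_mem_openCone hz
  have h3 : y + (x + t • e) = x + y + t • e := by abel
  rw [inv_inv, h3] at h1
  nlinarith

/-- The new direction is dominated by `B e`, so `p(v + s (x + t e)) ≤ p(v + B s e)`, which has order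
`s ^ nullity p e v`. -/
theorem rank_le_rank_of_direction {x v : Fin n → ℝ} (hx : x ∈ cone p e) (hv : v ∈ cone p e)
    {t : ℝ} (ht : 0 < t) : rank p (x + t • e) v ≤ rank p e v := by
  have hz := hp.add_smul_mem_openCone hx ht
  have hpz := hp.of_mem_openCone hz
  obtain ⟨C, hC, hup⟩ := hp.exists_le_mul_pow_nullity hv
  obtain ⟨B, hB, hBz⟩ := hp.exists_smul_sub_mem_cone (x + t • e)
  suffices hn : nullity p e v ≤ nullity p (x + t • e) v by
    have h1 := hp.nullity_add_rank v
    have h2 := hpz.nullity_add_rank v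
    omega
  refine hpz.le_nullity_of_eval_le (hp.cone_subset_cone hz hv) (C := C * B ^ nullity p e v)
    (δ := B⁻¹) (by positivity) fun s hs hsB => ?_
  have h1 : v + s • (x + t • e) = (v + s • x) + (s * t) • e := by module
  have h2 := hp.eval_le_eval_add (hp.add_smul_mem_openCone
    (hp.add_mem_cone hv (hp.smul_mem_cone hx hs.le)) (mul_pos hs ht))
    (hp.smul_mem_cone hBz hs.le)
  have h3 : s • (B • e - (x + t • e)) + (v + s • x + (s * t) • e) = v + (B * s) • e := by module
  rw [h3, ← h1] at h2
  refine (h2.trans (hup (B * s) (mul_pos hB hs) ?_)).trans_eq (by rw [mul_pow, mul_assoc])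
  calc B * s ≤ B * B⁻¹ := mul_le_mul_of_nonneg_left hsB hB.le
    _ = 1 := mul_inv_cancel₀ hB.ne'

/-- In direction `x + t e`, `v` has at most `rank p e v` nonzero eigenvalues, each at most `D / t`.
Adding `v` thus multiplies `p(x + t e)` by at most a constant times `t ^ (-rank p e v)`, lowering
the order of vanishing by at most `rank p e v`. -/
theorem rank_add_le {x v : Fin n → ℝ} (hx : x ∈ cone p e) (hv : v ∈ cone p e) :
    rank p e (x + v) ≤ rank p e x + rank p e v := by
  have hxv := hp.add_mem_cone hx hv
  suffices hn : nullity p e x - rank p e v ≤ nullity p e (x + v) by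
    have h1 := hp.nullity_add_rank x
    have h2 := hp.nullity_add_rank (x + v)
    omega
  rcases le_total (nullity p e x) (rank p e v) with hle | hle
  · omega
  obtain ⟨C, hC, hup⟩ := hp.exists_le_mul_pow_nullity hx
  obtain ⟨B, hB, hBv⟩ := hp.exists_smul_sub_mem_cone v
  set D := (1 + B) ^ d with hD
  have hD0 : 0 < D := by positivity
  refine hp.le_nullity_of_eval_le hxv (C := C * (1 + D) ^ rank p e v) (δ := 1) one_pos
    fun t ht ht1 => ?_
  have hz := hp.add_smul_mem_openCone hx ht
  have hpz := hp.of_mem_openCone hz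
  have hpos := hp.eval_pos_of_mem_openCone hz
  have hvz := hp.cone_subset_cone hz hv
  have hgrow : MvPolynomial.eval (t • v + (x + t • e)) p ≤
      D * MvPolynomial.eval (x + t • e) p := by
    have h1 := hp.eval_le_eval_add
      (hp.add_smul_mem_openCone (hp.add_mem_cone hx (hp.smul_mem_cone hv ht.le)) ht)
      (hp.smul_mem_cone hBv ht.le)
    have h2 : t • (B • e - v) + (x + t • v + t • e) = x + ((1 + B) * t) • e := by module
    have h3 : t • v + (x + t • e) = x + t • v + t • e := by abel
    rw [h2] at h1
    rw [h3]
    exact h1.trans (hp.eval_mul_add_smul_le hx (by linarith) ht.le)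
  -- An eigenvalue `r` of `v` makes `p` grow by at least `1 + r t` when `t v` is added, while
  -- `hgrow` allows at most `D`.
  have hν : ∀ r ∈ eigenvalues p (x + t • e) v, r ≤ D / t := by
    intro r hr
    rcases (hvz r hr).eq_or_lt with h0 | h0
    · rw [← h0]
      positivity
    · rw [hpz.mem_eigenvalues_iff] at hr
      have h1 : x + t • e - (r * t)⁻¹ • t • v = (-r⁻¹) • (v + (-r) • (x + t • e)) := by
        rw [smul_add (-r⁻¹), smul_smul, smul_smul, mul_inv, mul_assoc, inv_mul_cancel₀ ht.ne',
          neg_mul_neg, inv_mul_cancel₀ h0.ne']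
        module
      have h2 := hp.mul_one_add_inv_le_eval_add hz (hp.smul_mem_cone hv ht.le)
        (s := (r * t)⁻¹) (by positivity) (by
          rw [h1, eval_smul_of_isHomogeneous hp.homogeneous, hr, mul_zero])
      rw [inv_inv] at h2
      have h3 := h2.trans hgrow
      rw [mul_comm] at h3
      have h4 := le_of_mul_le_mul_right h3 hpos
      rw [le_div_iff₀ ht]
      linarith
  have hprod := prod_one_add_le hvz hν
  have hrank : (1 + D / t) ^ ((eigenvalues p (x + t • e) v).filter fun r => r ≠ 0).card ≤
      ((1 + D) / t) ^ rank p e v := by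
    have h1 : 1 ≤ 1 + D / t := le_add_of_nonneg_right (by positivity)
    have h2 : 1 + D / t ≤ (1 + D) / t := by
      rw [add_div]
      have : 1 ≤ 1 / t := by rwa [le_div_iff₀ ht, one_mul]
      linarith
    exact (pow_le_pow_right₀ h1 (hp.rank_le_rank_of_direction hx hv ht)).trans
      (pow_le_pow_left₀ (by positivity) h2 _)
  have h := hpz.eval_add_smul v 1
  rw [one_smul] at h
  have h5 : x + v + t • e = v + (x + t • e) := by abel
  rw [h5, h]
  calc MvPolynomial.eval (x + t • e) p *
        ((eigenvalues p (x + t • e) v).map fun r => 1 + r).prod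
      ≤ (C * t ^ nullity p e x) * ((1 + D) / t) ^ rank p e v :=
        mul_le_mul (hup t ht ht1) (hprod.trans hrank)
          (prod_add_nonneg hvz zero_le_one) (by positivity)
    _ = C * (1 + D) ^ rank p e v * t ^ (nullity p e x - rank p e v) := by
        obtain ⟨j, hj⟩ := Nat.exists_eq_add_of_le hle
        rw [hj, Nat.add_sub_cancel_left, div_pow, pow_add]
        field_simp

theorem rank_self : rank p e e = d := by
  have h : nullity p e e = 0 := by
    rw [nullity, Multiset.count_eq_zero, hp.mem_eigenvalues_iff]
    simpa using hp.eval_pos.ne'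
  have := hp.nullity_add_rank e
  omega

theorem rank_zero : rank p e 0 = 0 := by
  rw [rank, Multiset.card_eq_zero, Multiset.filter_eq_nil]
  intro r hr
  rw [hp.mem_eigenvalues_iff, zero_add, eval_smul_of_isHomogeneous hp.homogeneous] at hr
  simpa using eq_zero_of_pow_eq_zero ((mul_eq_zero.1 hr).resolve_right hp.eval_pos.ne')

end IsHyperbolic

end Hyperbolic

namespace ConeFaces

/-! ### Minimal faces of convex cones. -/

section MinimalFace

variable {E : Type*} [AddCommGroup E] [Module ℝ E]

/-- The smallest face of the convex cone `K` that contains `x`. -/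
def minimalFace (K : Set E) (x : E) : Set E :=
  {y | y ∈ K ∧ ∃ ε : ℝ, 0 < ε ∧ x - ε • y ∈ K}

variable {K : Set E} (hadd : ∀ x ∈ K, ∀ y ∈ K, x + y ∈ K)
  (hsmul : ∀ x ∈ K, ∀ c : ℝ, 0 ≤ c → c • x ∈ K)

include hadd hsmul

theorem sub_smul_mem_of_le {x y : E} (hx : x ∈ K) {ε δ : ℝ} (hε : 0 < ε) (hδ : 0 ≤ δ)
    (hle : δ ≤ ε) (h : x - ε • y ∈ K) : x - δ • y ∈ K := by
  have h1 := hadd _ (hsmul _ hx (1 - δ / ε) (sub_nonneg.2 ((div_le_one hε).2 hle)))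
    _ (hsmul _ h (δ / ε) (by positivity))
  have h2 : (1 - δ / ε) • x + (δ / ε) • (x - ε • y) = x - δ • y := by
    rw [smul_sub, smul_smul, div_mul_cancel₀ _ hε.ne']
    module
  rwa [h2] at h1

theorem isFace_minimalFace {x : E} (hx : x ∈ K) : IsFace K (minimalFace K x) where
  convex := by
    rintro y ⟨hy, ε, hε, hyε⟩ z ⟨hz, δ, hδ, hzδ⟩ a b ha hb hab
    refine ⟨hadd _ (hsmul _ hy a ha) _ (hsmul _ hz b hb), min ε δ, by positivity, ?_⟩
    have h1 := sub_smul_mem_of_le hadd hsmul hx hε (by positivity) (min_le_left ε δ) hyε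
    have h2 := sub_smul_mem_of_le hadd hsmul hx hδ (by positivity) (min_le_right ε δ) hzδ
    have h3 := hadd _ (hsmul _ h1 a ha) _ (hsmul _ h2 b hb)
    have h4 : a • (x - min ε δ • y) + b • (x - min ε δ • z) =
        (a + b) • x - min ε δ • (a • y + b • z) := by module
    rwa [h4, hab, one_smul] at h3
  subset := fun _ hy => hy.1
  mem_of_mem := by
    rintro y hy z hz α hα hα1 ⟨-, ε, hε, h⟩
    have hα1' : 0 < 1 - α := by linarith
    refine ⟨⟨hy, ε * α, by positivity, ?_⟩, ⟨hz, ε * (1 - α), by positivity, ?_⟩⟩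
    · have h1 := hadd _ h _ (hsmul _ hz (ε * (1 - α)) (by positivity))
      convert h1 using 1
      module
    · have h1 := hadd _ h _ (hsmul _ hy (ε * α) (by positivity))
      convert h1 using 1
      module

omit hadd in
theorem self_mem_minimalFace {x : E} (hx : x ∈ K) : x ∈ minimalFace K x :=
  ⟨hx, 1 / 2, by norm_num, by
    have h := hsmul _ hx (1 / 2) (by norm_num)
    convert h using 1
    module⟩

theorem minimalFace_subset_minimalFace {x y : E} (h : y ∈ minimalFace K x) :
    minimalFace K y ⊆ minimalFace K x := by
  obtain ⟨hy, ε, hε, h⟩ := h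
  rintro z ⟨hz, δ, hδ, h'⟩
  refine ⟨hz, ε * δ, by positivity, ?_⟩
  have h1 := hadd _ h _ (hsmul _ h' ε hε.le)
  convert h1 using 1
  module

/-- A face of a convex cone that contains `x` contains every point of the minimal face of `x`. -/
theorem IsFace.mem_of_sub_smul_mem {F : Set E} (hF : IsFace K F) {x y : E} (hx : x ∈ F)
    (hy : y ∈ K) {ε : ℝ} (hε : 0 < ε) (h : x - ε • y ∈ K) : y ∈ F := by
  have h1 : 0 < 1 + ε := by positivity
  have hz := hadd _ (hsmul _ (hF.subset hx) ε hε.le) _ h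
  refine (hF.mem_of_mem y hy _ hz (ε / (1 + ε)) (by positivity)
    ((div_lt_one h1).2 (by linarith)) ?_).1
  have h2 : (ε / (1 + ε)) • y + (1 - ε / (1 + ε)) • (ε • x + (x - ε • y)) = x := by
    have h3 : 1 - ε / (1 + ε) = 1 / (1 + ε) := by field_simp; ring
    rw [h3]
    match_scalars <;> field_simp <;> ring
  rwa [h2]

/-- If arbitrarily large multiples of `v` could be subtracted, then `ε x - v ∈ K` for all `ε > 0`;
in the limit `-v ∈ K`, against pointedness. -/
theorem exists_maximal_sub_smul_mem [TopologicalSpace E] [ContinuousSub E] [ContinuousSMul ℝ E]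
    (hclosed : IsClosed K) (hpointed : IsPointed K) {x v : E} (hx : x ∈ K) (hv : v ∈ K)
    (hv0 : v ≠ 0) :
    ∃ t : ℝ, 0 ≤ t ∧ x - t • v ∈ K ∧ ∀ ε : ℝ, 0 < ε → x - t • v - ε • v ∉ K := by
  set S : Set ℝ := {t | 0 ≤ t ∧ x - t • v ∈ K} with hS
  have hSclosed : IsClosed S :=
    IsClosed.and isClosed_Ici (hclosed.preimage (f := fun t : ℝ => x - t • v) (by fun_prop))
  have hSne : S.Nonempty := ⟨0, le_rfl, by simpa using hx⟩
  have hSbdd : BddAbove S := by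
    by_contra hb
    rw [not_bddAbove_iff] at hb
    have h1 : ∀ ε : ℝ, 0 < ε → ε • x - v ∈ K := fun ε hε => by
      obtain ⟨t, ⟨ht0, ht⟩, hlt⟩ := hb ε⁻¹
      have htpos : 0 < t := (inv_pos.2 hε).trans hlt
      have h2 := sub_smul_mem_of_le hadd hsmul hx htpos (inv_pos.2 hε).le hlt.le ht
      have h3 := hsmul _ h2 ε hε.le
      rwa [smul_sub, smul_smul, mul_inv_cancel₀ hε.ne', one_smul] at h3
    have hlim : Filter.Tendsto (fun ε : ℝ => ε • x - v) (nhdsWithin 0 (Set.Ioi 0))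
        (nhds ((0 : ℝ) • x - v)) :=
      (Continuous.tendsto (by fun_prop) (0 : ℝ)).mono_left nhdsWithin_le_nhds
    have h4 := hclosed.mem_of_tendsto hlim (eventually_nhdsWithin_of_forall fun ε hε => h1 ε hε)
    rw [zero_smul, zero_sub] at h4
    have h5 : v ∈ K ∩ -K := ⟨hv, h4⟩
    rw [hpointed] at h5
    exact hv0 h5
  have hmem := hSclosed.csSup_mem hSne hSbdd
  refine ⟨sSup S, hmem.1, hmem.2, fun ε hε h => ?_⟩
  have h1 : sSup S + ε ∈ S := ⟨add_nonneg hmem.1 hε.le, by rwa [add_smul, ← sub_sub]⟩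
  have := le_csSup hSbdd h1
  linarith

end MinimalFace

end ConeFaces

namespace Hyperbolic

/-! ### Chains of faces of the hyperbolicity cone. -/

namespace IsHyperbolic

open ConeFaces

variable {n d : ℕ} {p : MvPolynomial (Fin n) ℝ} {e : Fin n → ℝ}
  (hp : IsHyperbolic p e d)
include hp

theorem add_mem_cone' : ∀ x ∈ cone p e, ∀ y ∈ cone p e, x + y ∈ cone p e :=
  fun _ hx _ hy => hp.add_mem_cone hx hy

theorem smul_mem_cone' : ∀ x ∈ cone p e, ∀ c : ℝ, 0 ≤ c → c • x ∈ cone p e :=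
  fun _ hx _ hc => hp.smul_mem_cone hx hc

theorem rank_lt_rank_midpoint {F : Set (Fin n → ℝ)} (hF : IsFace (cone p e) F) {x y : Fin n → ℝ}
    (hx : x ∈ F) (hy : y ∈ cone p e) (hyF : y ∉ F) :
    rank p e x < rank p e ((1 / 2 : ℝ) • x + (1 / 2 : ℝ) • y) := by
  by_contra! hle
  have hxK := hF.subset hx
  have hm := hp.add_mem_cone (hp.smul_mem_cone hxK (c := 1 / 2) (by norm_num))
    (hp.smul_mem_cone hy (c := 1 / 2) (by norm_num))
  have h1 := hp.rank_le_rank_of_sub_mem hm (hp.add_mem_cone hxK hy) (ε := 1 / 2) (by norm_num) (by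
    convert hp.zero_mem_cone using 1
    module)
  obtain ⟨ε, hε, h⟩ := hp.exists_sub_smul_mem_cone hxK hy (h1.trans hle)
  exact hyF (hF.mem_of_sub_smul_mem hp.add_mem_cone' hp.smul_mem_cone' hx hy hε h)

theorem sSup_rank_lt_sSup_rank {F G : Set (Fin n → ℝ)} (hF : IsFace (cone p e) F)
    (hG : IsFace (cone p e) G) (hne : F.Nonempty) (hFG : F ⊂ G) :
    sSup (rank p e '' F) < sSup (rank p e '' G) := by
  have hbdd : ∀ F : Set (Fin n → ℝ), BddAbove (rank p e '' F) := fun F =>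
    ⟨d, by rintro _ ⟨x, -, rfl⟩; exact hp.rank_le x⟩
  obtain ⟨x, hx, hxF⟩ := Nat.sSup_mem (hne.image (rank p e)) (hbdd F)
  obtain ⟨y, hyG, hyF⟩ := Set.exists_of_ssubset hFG
  rw [← hxF]
  refine (hp.rank_lt_rank_midpoint hF hx (hG.subset hyG) hyF).trans_le
    (le_csSup (hbdd G) ⟨_, ?_, rfl⟩)
  exact hG.convex (hFG.subset hx) hyG (by norm_num) (by norm_num) (by norm_num)

theorem chainLength_cone_le : chainLength (cone p e) ≤ (d : ℕ∞) + 1 := by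
  refine iSup_le ?_
  rintro ⟨T, hT, hchain⟩
  have h1 : T.encard ≤ (Finset.range (d + 1) : Set ℕ).encard := by
    refine Set.encard_le_encard_of_injOn (f := fun F => sSup (rank p e '' F)) ?_ ?_
    · intro F hF
      rw [Finset.mem_coe, Finset.mem_range, Nat.lt_succ_iff]
      refine csSup_le ((hT hF).2.image _) ?_
      rintro _ ⟨x, -, rfl⟩
      exact hp.rank_le x
    · intro F hF G hG hFG
      by_contra hne
      rcases hchain hF hG hne with h | h
      · exact (hp.sSup_rank_lt_sSup_rank (hT hF).1 (hT hG).1 (hT hF).2 h).ne hFG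
      · exact (hp.sSup_rank_lt_sSup_rank (hT hG).1 (hT hF).1 (hT hG).2 h).ne' hFG
  refine h1.trans_eq ?_
  rw [Set.encard_coe_eq_coe_finsetCard, Finset.card_range]
  rfl

variable (hpointed : IsPointed (cone p e))
include hpointed

/-- Take a nonzero `y` of minimal rank in the minimal face of `x`. For nonzero `z` in the minimal
face of `y`, subtract the largest possible `t z`. If the remainder `u` were nonzero, minimality
would give it at least the rank of `y`, so `u - ε y` would lie in the cone and more of `z` could be
subtracted. Hence `y = t z`. -/
theorem exists_isExtremeRay {x : Fin n → ℝ} (hx : x ∈ cone p e) (hx0 : x ≠ 0) :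
    ∃ v ∈ minimalFace (cone p e) x, v ≠ 0 ∧
      IsExtremeRay (cone p e) {y | ∃ t : ℝ, 0 ≤ t ∧ y = t • v} := by
  have hadd := hp.add_mem_cone'
  have hsmul := hp.smul_mem_cone'
  obtain ⟨y, ⟨hyx, hy0⟩, hmin⟩ := (measure (rank p e)).wf.has_min
    {y | y ∈ minimalFace (cone p e) x ∧ y ≠ 0} ⟨x, self_mem_minimalFace hsmul hx, hx0⟩
  have hyK := hyx.1
  have hray : minimalFace (cone p e) y = {z | ∃ t : ℝ, 0 ≤ t ∧ z = t • y} := by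
    ext z
    constructor
    · rintro ⟨hz, δ, hδ, hzδ⟩
      by_cases hz0 : z = 0
      · exact ⟨0, le_rfl, by rw [hz0, zero_smul]⟩
      obtain ⟨t, ht, hu, hmax⟩ :=
        exists_maximal_sub_smul_mem hadd hsmul hp.isClosed_cone hpointed hyK hz hz0
      by_cases hu0 : y - t • z = 0
      · rw [sub_eq_zero] at hu0
        have ht0 : t ≠ 0 := by
          rintro rfl
          exact hy0 (by rw [hu0, zero_smul])
        refine ⟨t⁻¹, inv_nonneg.2 ht, ?_⟩
        rw [hu0, smul_smul, inv_mul_cancel₀ ht0, one_smul]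
      · exfalso
        have huy : y - t • z ∈ minimalFace (cone p e) y :=
          ⟨hu, 1, one_pos, by simpa using hp.smul_mem_cone hz ht⟩
        have h1 := hmin _ ⟨minimalFace_subset_minimalFace hadd hsmul hyx huy, hu0⟩
        have h2 : rank p e y ≤ rank p e (y - t • z) := not_lt.1 h1
        -- With `u = y - t z`, the difference `y - (u + y) / 2` equals `(t / 2) z`.
        have h3 := hp.rank_le_rank_of_sub_mem hyK (hp.add_mem_cone hu hyK) (ε := 1 / 2)
          (by norm_num) (by
            convert hp.smul_mem_cone hz (c := t / 2) (by positivity) using 1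
            module)
        obtain ⟨ε, hε, h4⟩ := hp.exists_sub_smul_mem_cone hu hyK (h3.trans h2)
        refine hmax (ε * δ) (by positivity) ?_
        convert hp.add_mem_cone h4 (hp.smul_mem_cone hzδ hε.le) using 1
        module
    · rintro ⟨t, ht, rfl⟩
      have ht1 : 0 < t + 1 := by positivity
      refine ⟨hp.smul_mem_cone hyK ht, (t + 1)⁻¹, inv_pos.2 ht1, ?_⟩
      convert hp.smul_mem_cone hyK (c := (t + 1)⁻¹) (by positivity) using 1
      match_scalars
      field_simp
      ring
  exact ⟨y, hyx, hy0, hray ▸ isFace_minimalFace hadd hsmul hyK, y, hy0, rfl⟩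

/-- Subtracting a maximal multiple of an extreme ray costs at most one unit of rank and strictly
shrinks the minimal face. The cost may be smaller than one, hence `k ≤ rank p e x` rather than
equality. -/
theorem exists_chain_of_le_rank
    (hrank : ∀ R : Set (Fin n → ℝ), IsExtremeRay (cone p e) R →
      ∀ x ∈ R, x ≠ 0 → rank p e x = 1) (k : ℕ) :
    ∀ x ∈ cone p e, k ≤ rank p e x → ∃ T : Set (Set (Fin n → ℝ)),
      T ⊆ {F | IsFace (cone p e) F ∧ F.Nonempty} ∧ IsChain (fun F G => F ⊂ G) T ∧
      T.encard = (k : ℕ∞) + 1 ∧ ∀ F ∈ T, F ⊆ minimalFace (cone p e) x := by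
  have hadd := hp.add_mem_cone'
  have hsmul := hp.smul_mem_cone'
  have hface : ∀ x ∈ cone p e, minimalFace (cone p e) x ∈
      {F | IsFace (cone p e) F ∧ F.Nonempty} := fun x hx =>
    ⟨isFace_minimalFace hadd hsmul hx, x, self_mem_minimalFace hsmul hx⟩
  induction k with
  | zero =>
    intro x hx _
    refine ⟨{minimalFace (cone p e) x}, Set.singleton_subset_iff.2 (hface x hx),
      IsChain.singleton, by simp, ?_⟩
    rintro F rfl
    exact subset_rfl
  | succ k ih =>
    intro x hx hk
    have hx0 : x ≠ 0 := by
      rintro rfl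
      rw [hp.rank_zero] at hk
      omega
    obtain ⟨v, ⟨hvK, δ, hδ, hvδ⟩, hv0, hv⟩ := hp.exists_isExtremeRay hpointed hx hx0
    obtain ⟨t, ht, hu, hmax⟩ :=
      exists_maximal_sub_smul_mem hadd hsmul hp.isClosed_cone hpointed hx hvK hv0
    have ht0 : t ≠ 0 := by
      rintro rfl
      exact hmax δ hδ (by simpa using hvδ)
    have hrv : rank p e (t • v) = 1 := hrank _ hv _ ⟨t, ht, rfl⟩ (smul_ne_zero ht0 hv0)
    have hru := hp.rank_add_le hu (hp.smul_mem_cone hvK ht)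
    rw [sub_add_cancel, hrv] at hru
    obtain ⟨T, hT, hchain, hcard, hsub⟩ := ih _ hu (by omega)
    have hux : x - t • v ∈ minimalFace (cone p e) x :=
      ⟨hu, 1, one_pos, by simpa using hp.smul_mem_cone hvK ht⟩
    have hss : ∀ F ∈ T, F ⊂ minimalFace (cone p e) x := fun F hF => by
      refine (hsub F hF).trans_ssubset
        ⟨minimalFace_subset_minimalFace hadd hsmul hux, fun hle => ?_⟩
      -- If the faces agreed, some `ε x` could be removed from `x - t v`, hence also `ε δ v`,
      -- against maximality of `t`.
      obtain ⟨-, ε, hε, h⟩ := hle (self_mem_minimalFace hsmul hx)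
      refine hmax (ε * δ) (by positivity) ?_
      convert hp.add_mem_cone h (hp.smul_mem_cone hvδ hε.le) using 1
      module
    refine ⟨insert (minimalFace (cone p e) x) T, Set.insert_subset (hface x hx) hT,
      hchain.insert fun F hF _ => Or.inr (hss F hF), ?_, ?_⟩
    · rw [Set.encard_insert_of_notMem fun h => (hss _ h).ne rfl, hcard]
      push_cast
      rfl
    · rintro F (rfl | hF)
      · exact subset_rfl
      · exact (hss F hF).subset

end IsHyperbolic

end Hyperbolic

theorem proposition2p2 (n d : ℕ) (p : MvPolynomial (Fin n) ℝ) (e : Fin n → ℝ)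
    (hp : Hyperbolic.IsHyperbolic p e d)
    (hpointed : ConeFaces.IsPointed (Hyperbolic.cone p e))
    (hrank : ∀ R : Set (Fin n → ℝ), ConeFaces.IsExtremeRay (Hyperbolic.cone p e) R →
      ∀ x ∈ R, x ≠ 0 → Hyperbolic.rank p e x = 1) :
    ConeFaces.chainLength (Hyperbolic.cone p e) = (d : ℕ∞) + 1 := by
  refine le_antisymm hp.chainLength_cone_le ?_
  obtain ⟨T, hT, hchain, hcard, -⟩ :=
    hp.exists_chain_of_le_rank hpointed hrank d e hp.self_mem_cone hp.rank_self.ge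
  rw [← hcard]
  exact Set.encard_le_chainHeight_of_isChain _ T hT hchain
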